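/- Let $G=(V,E)$ be a finite simple graph with edge weights $w_{ij}=w_{ji}\in[0,1]$ for $(i,j)\in E$ and capacities $b_i\in\{1,2,3,\dots\}$ for $i\in V$. Write $\partial i$ for the set of neighbours of $i$ and $(x)_+=\max(x,0)$. For $b\ge 1$, let $b\text{-}\max$ of a finite family of nonnegative reals denote its $b$-th largest member, counted with multiplicity, or $0$ if the family has fewer than $b$ members. A message vector $\underline\alpha$ consists of a real number $\alpha_{i\backslash j}$ for every ordered pair $(i,j)$ of adjacent vertices ($2|E|$ numbers). It determines the offers $$m_{i\to j}|_{\underline\alpha}=(w_{ij}-\alpha_{i\backslash j})_+-\tfrac12\,(w_{ij}-\alpha_{i\backslash j}-\alpha_{j\backslash i})_+ .$$ Fix $\kappa\in(0,1)$. Given an initial message vector $\underline\alpha^0$, the natural dynamics with capacities $(b_i)$ is the sequence defined for $t=0,1,2,\dots$ by $$\alpha_{i\backslash j}^{t+1}=(1-\kappa)\,\alpha_{i\backslash j}^{t}+\kappa\; b_i\text{-}\max_{k\in\partial i\setminus\{j\}}\; m_{k\to i}|_{\underline\alpha^t}.$$ A message vector $\underline\alpha$ is an $\epsilon$-fixed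 point if $\big|\alpha_{i\backslash j}-b_i\text{-}\max_{k\in\partial i\setminus\{j\}} m_{k\to i}|_{\underline\alpha}\big|\le\epsilon$ for every ordered pair $(i,j)$ of adjacent vertices. Theorem. For every initial condition $\underline\alpha^0\in[0,1]^{2|E|}$ and every $\epsilon>0$, put $$T^*(\epsilon)=\frac{1}{\pi\,\kappa(1-\kappa)\,\epsilon^2}.$$ Then for every integer $t\ge T^*(\epsilon)$, $\underline\alpha^t$ is an $\epsilon$-fixed point. (Here $\pi=3.14159\ldots$) -/

import Mathlib

noncomputable section

namespace Bargaining

/-- The `b`-th largest element (`b ≥ 1`), counted with multiplicity, of a finite family of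
reals; it is `0` if the family has fewer than `b` members. -/
def bMax (b : ℕ) (s : Multiset ℝ) : ℝ :=
  (s.sort (fun x y => x ≥ y)).getD (b - 1) 0

variable {V : Type*} [Fintype V] [DecidableEq V] (G : SimpleGraph V) [DecidableRel G.Adj]

/-- A message vector: one real for every directed edge (`2|E|` coordinates). For the dart
`d = (i, j)`, the coordinate `α d` is the message sent by `i` to `j`, i.e. the best alternative
that `i` estimates if she does not trade with `j`. -/
abbrev Messages : Type _ := G.Dart → ℝ

/-- The offer `m_{i→j} = (w_{ij} - α_{i\j})₊ - ½ (w_{ij} - α_{i\j} - α_{j\i})₊` made along the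
dart `d = (i, j)`. -/
def offer (w : Sym2 V → ℝ) (α : Messages G) (d : G.Dart) : ℝ :=
  max (w d.edge - α d) 0 - (1 / 2) * max (w d.edge - α d - α d.symm) 0

/-- For the dart `d = (i, j)`: the `b_i`-th largest of the offers `m_{k→i}`, where `k` runs over
the neighbours of `i` other than `j`. -/
def bestAlternative (w : Sym2 V → ℝ) (b : V → ℕ) (α : Messages G) (d : G.Dart) : ℝ :=
  bMax (b d.fst)
    ((Finset.univ.filter fun e : G.Dart => e.snd = d.fst ∧ e.fst ≠ d.snd).val.map
      (offer G w α))

/-- The natural dynamics with capacities `b`, damping factor `κ` and initial messages `α₀`. -/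
def naturalDynamics (w : Sym2 V → ℝ) (b : V → ℕ) (κ : ℝ) (α₀ : Messages G) : ℕ → Messages G
  | 0 => α₀
  | t + 1 => fun d =>
      (1 - κ) * naturalDynamics w b κ α₀ t d
        + κ * bestAlternative G w b (naturalDynamics w b κ α₀ t) d

/-- `α` is an `ε`-fixed point: every message is within `ε` of the best alternative computed
from `α`. -/
def IsApproxFixedPoint (w : Sym2 V → ℝ) (b : V → ℕ) (ε : ℝ) (α : Messages G) : Prop :=
  ∀ d : G.Dart, |α d - bestAlternative G w b α d| ≤ ε

end Bargaining

end

/-!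
For the sup norm the map sending `α` to its best alternatives is nonexpansive: an offer equals
`(|u| + min u y) / 2` with `u = w - α` and `y` the opposite message, and the `b`-th largest member
of a family moves by at most the largest displacement of a member. The natural dynamics is thus a
Krasnoselskii–Mann iteration `x (n + 1) = (1 - κ) x n + κ T (x n)`, and the rate is that of Baillon
and Bruck.

To obtain their constant, `‖x m - T (x n)‖` and `‖x m - x n‖`, for `m ≤ n`, are compared with the
expectation of `sign (k + Y - X)` at `k = 1` and `k = 0`, where `X` and `Y` are independent binomial
variables with `m` and `n` trials of success probability `κ`; this expectation satisfies with
equality the recursion that the convexity of the norm gives as an inequality. For `m = n` and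
`k = 1` it is a cosine integral of powers of `|1 - κ + κ exp (iθ)|² = 1 - 2 κ (1 - κ) (1 - cos θ)`,
which the substitution `s = sin (θ / 2)` bounds by a Gaussian integral.
-/

open Real Set

namespace Bargaining

section OrderStatistics

theorem le_getElem_iff_lt_countP {α : Type*} [LinearOrder α] {l : List α}
    (hl : l.Pairwise (· ≥ ·)) {i : ℕ} (hi : i < l.length) (c : α) :
    c ≤ l[i] ↔ i < l.countP (c ≤ ·) := by
  have hanti : ∀ {j k : ℕ} (hk : k < l.length) (hjk : j ≤ k), l[k] ≤ l[j] := fun hk hjk =>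
    hjk.eq_or_lt.elim (fun h => by subst h; rfl)
      fun h => List.pairwise_iff_getElem.1 hl _ _ (h.trans hk) hk h
  constructor
  · intro hc
    have htake : (l.take (i + 1)).countP (c ≤ ·) = (l.take (i + 1)).length := by
      rw [List.countP_eq_length]
      intro x hx
      obtain ⟨j, hj, rfl⟩ := List.mem_take_iff_getElem.1 hx
      exact decide_eq_true (hc.trans (hanti hi (by omega)))
    have hle := (List.take_sublist (i + 1) l).countP_le (p := (c ≤ ·))
    rw [htake, List.length_take] at hle
    omega
  · contrapose!
    intro hc
    have hdrop : (l.drop i).countP (c ≤ ·) = 0 := by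
      rw [List.countP_eq_zero]
      intro x hx
      obtain ⟨j, hj, rfl⟩ := List.mem_drop_iff_getElem.1 hx
      have hle : l[i + j] ≤ l[i] := hanti _ (Nat.le_add_right i j)
      simpa using hle.trans_lt hc
    rw [← List.take_append_drop i l, List.countP_append, hdrop, add_zero]
    exact List.countP_le_length.trans (List.length_take_le i l)

theorem le_bMax_iff_le_countP {b : ℕ} (hb : 1 ≤ b) {s : Multiset ℝ} (hs : b ≤ s.card) (c : ℝ) :
    c ≤ bMax b s ↔ b ≤ s.countP (c ≤ ·) := by
  have hi : b - 1 < (s.sort (· ≥ ·)).length := by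
    rw [Multiset.length_sort]
    omega
  have hcount : s.countP (c ≤ ·) = (s.sort (· ≥ ·)).countP (c ≤ ·) := by
    rw [← Multiset.coe_countP, Multiset.sort_eq]
  rw [bMax, List.getD_eq_getElem _ _ hi,
    le_getElem_iff_lt_countP (Multiset.pairwise_sort s _) hi, hcount]
  omega

theorem bMax_eq_zero_of_card_lt {b : ℕ} {s : Multiset ℝ} (hs : s.card < b) : bMax b s = 0 :=
  List.getD_eq_default _ _ (by rw [Multiset.length_sort]; omega)

theorem bMax_mem_of_forall_mem {I : Set ℝ} (hI : (0 : ℝ) ∈ I) (b : ℕ) {s : Multiset ℝ}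
    (hs : ∀ x ∈ s, x ∈ I) : bMax b s ∈ I := by
  rcases lt_or_ge (b - 1) (s.sort (· ≥ ·)).length with hlt | hge
  · rw [bMax, List.getD_eq_getElem _ _ hlt]
    exact hs _ ((Multiset.mem_sort (· ≥ ·)).1 (List.getElem_mem hlt))
  · rwa [bMax, List.getD_eq_default _ _ hge]

variable {ι : Type*} {b : ℕ} {s : Multiset ι} {f g : ι → ℝ} {δ : ℝ}

theorem bMax_map_le_bMax_map_add (hb : 1 ≤ b) (hδ : 0 ≤ δ) (hfg : ∀ i ∈ s, f i ≤ g i + δ) :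
    bMax b (s.map f) ≤ bMax b (s.map g) + δ := by
  rcases lt_or_ge s.card b with hs | hs
  · rw [bMax_eq_zero_of_card_lt (by rwa [Multiset.card_map]),
      bMax_eq_zero_of_card_lt (by rwa [Multiset.card_map]), zero_add]
    exact hδ
  · have hcount := (le_bMax_iff_le_countP hb (by rwa [Multiset.card_map]) _).1
      (le_refl (bMax b (s.map f)))
    rw [← sub_le_iff_le_add, le_bMax_iff_le_countP hb (by rwa [Multiset.card_map])]
    refine hcount.trans ?_
    rw [Multiset.countP_map, Multiset.countP_map]
    refine Multiset.card_le_card (Multiset.le_filter.2 ⟨Multiset.filter_le _ _, fun i hi => ?_⟩)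
    obtain ⟨his, hle⟩ := Multiset.mem_filter.1 hi
    exact sub_le_iff_le_add.2 (hle.trans (hfg i his))

theorem abs_bMax_map_sub_le (hb : 1 ≤ b) (hδ : 0 ≤ δ) (hfg : ∀ i ∈ s, |f i - g i| ≤ δ) :
    |bMax b (s.map f) - bMax b (s.map g)| ≤ δ := by
  rw [abs_sub_le_iff, sub_le_iff_le_add, sub_le_iff_le_add, add_comm δ, add_comm δ]
  exact ⟨bMax_map_le_bMax_map_add hb hδ fun i hi =>
      sub_le_iff_le_add'.1 (abs_sub_le_iff.1 (hfg i hi)).1,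
    bMax_map_le_bMax_map_add hb hδ fun i hi =>
      sub_le_iff_le_add'.1 (abs_sub_le_iff.1 (hfg i hi)).2⟩

end OrderStatistics

section Offers

variable {V : Type*} (G : SimpleGraph V)

theorem offer_eq_half_abs_add_min (w : Sym2 V → ℝ) (α : Messages G) (d : G.Dart) :
    offer G w α d = (|w d.edge - α d| + min (w d.edge - α d) (α d.symm)) / 2 := by
  have hpos : max (w d.edge - α d) 0 = (w d.edge - α d + |w d.edge - α d|) / 2 := by
    grind
  have hmin : min (w d.edge - α d) (α d.symm) =
      w d.edge - α d - max (w d.edge - α d - α d.symm) 0 := by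
    rw [← min_sub_sub_left]
    simp [min_comm]
  rw [offer, hpos, hmin]
  ring

theorem abs_offer_sub_le (w : Sym2 V → ℝ) (α β : Messages G) (d : G.Dart) :
    |offer G w α d - offer G w β d| ≤ max |α d - β d| |α d.symm - β d.symm| := by
  have hu : |(w d.edge - α d) - (w d.edge - β d)| = |α d - β d| := by
    rw [sub_sub_sub_cancel_left, abs_sub_comm]
  have habs := hu ▸ abs_abs_sub_abs_le (w d.edge - α d) (w d.edge - β d)
  have hmin := hu ▸ abs_min_sub_min_le_max (w d.edge - α d) (α d.symm) (w d.edge - β d) (β d.symm)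
  rw [offer_eq_half_abs_add_min, offer_eq_half_abs_add_min, ← sub_div, add_sub_add_comm, abs_div,
    abs_two, div_le_iff₀ two_pos, mul_two]
  exact (abs_add_le _ _).trans (add_le_add (habs.trans (le_max_left _ _)) hmin)

theorem offer_mem_Icc {w : Sym2 V → ℝ} {α : Messages G} (hα : ∀ e, 0 ≤ α e) {M : ℝ} (hM : 0 ≤ M)
    {d : G.Dart} (hw : w d.edge ≤ M) : offer G w α d ∈ Icc 0 M := by
  have hd := hα d
  have hsymm := hα d.symm
  have hmax : max (w d.edge - α d - α d.symm) 0 ≤ max (w d.edge - α d) 0 :=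
    max_le_max_right 0 (sub_le_self _ hsymm)
  have hle : max (w d.edge - α d) 0 ≤ M := max_le (by linarith) hM
  have hnonneg := le_max_right (w d.edge - α d) 0
  have hnonneg' := le_max_right (w d.edge - α d - α d.symm) 0
  constructor <;> unfold offer <;> linarith

variable [Fintype V] [DecidableEq V] [DecidableRel G.Adj]

theorem lipschitzWith_bestAlternative (w : Sym2 V → ℝ) {b : V → ℕ} (hb : ∀ i, 1 ≤ b i) :
    LipschitzWith 1 (bestAlternative G w b) :=
  LipschitzWith.mk_one fun α β => (dist_pi_le_iff dist_nonneg).2 fun d =>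
    abs_bMax_map_sub_le (hb d.fst) dist_nonneg fun e _ =>
      (abs_offer_sub_le G w α β e).trans
        (max_le (dist_le_pi_dist α β e) (dist_le_pi_dist α β e.symm))

theorem bestAlternative_mem_Icc {w : Sym2 V → ℝ} {M : ℝ} (hM : 0 ≤ M)
    (hw : ∀ e ∈ G.edgeSet, w e ≤ M) (b : V → ℕ) {α : Messages G} (hα : ∀ e, 0 ≤ α e)
    (d : G.Dart) : bestAlternative G w b α d ∈ Icc 0 M := by
  refine bMax_mem_of_forall_mem (left_mem_Icc.2 hM) _ fun x hx => ?_
  obtain ⟨e, -, rfl⟩ := Multiset.mem_map.1 hx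
  exact offer_mem_Icc G hα hM (hw _ e.edge_mem)

theorem naturalDynamics_mem_Icc {w : Sym2 V → ℝ} {M : ℝ} (hM : 0 ≤ M)
    (hw : ∀ e ∈ G.edgeSet, w e ≤ M) (b : V → ℕ) {κ : ℝ} (hκ : κ ∈ Icc (0 : ℝ) 1)
    {α₀ : Messages G} (hα₀ : ∀ d, α₀ d ∈ Icc 0 M) (t : ℕ) (d : G.Dart) :
    naturalDynamics G w b κ α₀ t d ∈ Icc 0 M := by
  induction t generalizing d with
  | zero => exact hα₀ d
  | succ t ih =>
    exact convex_Icc 0 M (ih d) (bestAlternative_mem_Icc G hM hw b (fun e => (ih e).1) d)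
      (sub_nonneg.2 hκ.2) hκ.1 (sub_add_cancel 1 κ)

theorem norm_sub_bestAlternative_naturalDynamics_le {w : Sym2 V → ℝ} {M : ℝ} (hM : 0 ≤ M)
    (hw : ∀ e ∈ G.edgeSet, w e ≤ M) (b : V → ℕ) {κ : ℝ} (hκ : κ ∈ Icc (0 : ℝ) 1)
    {α₀ : Messages G} (hα₀ : ∀ d, α₀ d ∈ Icc 0 M) (t : ℕ) :
    ‖α₀ - bestAlternative G w b (naturalDynamics G w b κ α₀ t)‖ ≤ M := by
  refine (pi_norm_le_iff_of_nonneg hM).2 fun d => ?_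
  have hdyn := naturalDynamics_mem_Icc G hM hw b hκ hα₀ t
  exact (Real.dist_le_of_mem_Icc (hα₀ d)
    (bestAlternative_mem_Icc G hM hw b (fun e => (hdyn e).1) d)).trans_eq (sub_zero M)

end Offers

section SignAverage

/-- The average of `f` at `k` and `k + s` with weights `1 - κ` and `κ`: the expectation of `f` after
one step of a random walk on `ℤ` that jumps by `s` with probability `κ`. -/
noncomputable def shiftAverage (κ : ℝ) (s : ℤ) (f : ℤ → ℝ) (k : ℤ) : ℝ :=
  (1 - κ) * f k + κ * f (k + s)

theorem shiftAverage_commute (κ : ℝ) (s r : ℤ) :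
    Function.Commute (shiftAverage κ s) (shiftAverage κ r) := by
  intro f
  funext k
  simp only [shiftAverage, add_right_comm k r s]
  ring

/-- The expectation of `sign (k + Y - X)` for independent binomial variables `X` and `Y` with
parameters `(m, κ)` and `(n, κ)`, encoded by iterated averaging so that it satisfies the recursions
in `m` and `n` by construction. -/
noncomputable def signAverage (κ : ℝ) (m n : ℕ) : ℤ → ℝ :=
  (shiftAverage κ (-1))^[m] ((shiftAverage κ 1)^[n] fun k => (k.sign : ℝ))

variable (κ : ℝ)

theorem signAverage_zero_zero (k : ℤ) : signAverage κ 0 0 k = k.sign := rfl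

theorem signAverage_succ_left (m n : ℕ) (k : ℤ) :
    signAverage κ (m + 1) n k =
      (1 - κ) * signAverage κ m n k + κ * signAverage κ m n (k - 1) := by
  rw [signAverage, Function.iterate_succ_apply']
  rfl

theorem signAverage_succ_right (m n : ℕ) (k : ℤ) :
    signAverage κ m (n + 1) k =
      (1 - κ) * signAverage κ m n k + κ * signAverage κ m n (k + 1) := by
  rw [signAverage, Function.iterate_succ_apply',
    ((shiftAverage_commute κ (-1) 1).iterate_left m).eq]
  rfl

theorem signAverage_succ_succ (m n : ℕ) (k : ℤ) :
    signAverage κ (m + 1) (n + 1) k = (1 - 2 * (κ * (1 - κ))) * signAverage κ m n k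
      + κ * (1 - κ) * (signAverage κ m n (k + 1) + signAverage κ m n (k - 1)) := by
  rw [signAverage_succ_left, signAverage_succ_right, signAverage_succ_right, sub_add_cancel]
  ring

theorem signAverage_zero_left_of_pos (n : ℕ) {k : ℤ} (hk : 0 < k) : signAverage κ 0 n k = 1 := by
  induction n generalizing k with
  | zero => rw [signAverage_zero_zero, Int.sign_eq_one_of_pos hk, Int.cast_one]
  | succ n ih =>
    rw [signAverage_succ_right, ih hk, ih (by omega)]
    ring

theorem signAverage_self_neg (n : ℕ) (k : ℤ) : signAverage κ n n (-k) = -signAverage κ n n k := by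
  induction n generalizing k with
  | zero => rw [signAverage_zero_zero, signAverage_zero_zero, Int.sign_neg, Int.cast_neg]
  | succ n ih =>
    rw [signAverage_succ_succ, signAverage_succ_succ, ih,
      show -k + 1 = -(k - 1) by ring, show -k - 1 = -(k + 1) by ring, ih, ih]
    ring

theorem signAverage_self_zero (n : ℕ) : signAverage κ n n 0 = 0 :=
  self_eq_neg.1 (by simpa only [neg_zero] using signAverage_self_neg κ n 0)

end SignAverage

section FourierRepresentation

/-- The unnormalized `k`-th Fourier cosine coefficient of `g` on `[-π, π]`. -/
noncomputable def cosCoeff (g : ℝ → ℝ) (k : ℤ) : ℝ :=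
  ∫ θ in (-π)..π, g θ * cos (k * θ)

theorem cosCoeff_one (k : ℤ) : cosCoeff (fun _ => 1) k = if k = 0 then 2 * π else 0 := by
  simp only [cosCoeff, one_mul]
  split_ifs with hk
  · simp only [hk, Int.cast_zero, zero_mul, cos_zero, intervalIntegral.integral_const, smul_eq_mul]
    ring
  · rw [intervalIntegral.integral_comp_mul_left cos (Int.cast_ne_zero.2 hk), integral_cos, mul_neg,
      sin_neg, sin_int_mul_pi, neg_zero, sub_zero, smul_zero]

theorem cosCoeff_add_cos_mul {g : ℝ → ℝ} (hg : Continuous g) (a b : ℝ) (k : ℤ) :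
    cosCoeff (fun θ => (a + 2 * b * cos θ) * g θ) k =
      a * cosCoeff g k + b * (cosCoeff g (k + 1) + cosCoeff g (k - 1)) := by
  have hint (j : ℤ) :
      IntervalIntegrable (fun θ => g θ * cos (j * θ)) MeasureTheory.volume (-π) π :=
    Continuous.intervalIntegrable (by fun_prop) _ _
  have hprod (θ : ℝ) : (a + 2 * b * cos θ) * g θ * cos (k * θ) = a * (g θ * cos (k * θ)) +
      b * (g θ * cos ((k + 1 : ℤ) * θ) + g θ * cos ((k - 1 : ℤ) * θ)) := by
    push_cast
    rw [add_one_mul, sub_one_mul, cos_add, cos_sub]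
    ring
  simp only [cosCoeff, hprod]
  rw [intervalIntegral.integral_add ((hint k).const_mul _)
      (((hint _).add (hint _)).const_mul _),
    intervalIntegral.integral_const_mul, intervalIntegral.integral_const_mul,
    intervalIntegral.integral_add (hint _) (hint _)]

theorem sign_add_one_sub_sign_sub_one (k : ℤ) :
    (k + 1).sign - (k - 1).sign =
      (if k = 0 then 2 else 0) + (if k + 1 = 0 then 1 else 0) + (if k - 1 = 0 then 1 else 0) := by
  rcases lt_trichotomy k 0 with hk | rfl | hk
  · grind [Int.sign_eq_neg_one_of_neg]
  · decide
  · grind [Int.sign_eq_one_of_pos]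

theorem signAverage_self_add_one_sub (κ : ℝ) (n : ℕ) (k : ℤ) :
    signAverage κ n n (k + 1) - signAverage κ n n (k - 1) =
      cosCoeff (fun θ => (1 - 2 * (κ * (1 - κ)) * (1 - cos θ)) ^ n * (1 + cos θ)) k / π := by
  induction n generalizing k with
  | zero =>
    have hkernel := cosCoeff_add_cos_mul (g := fun _ => 1) continuous_const 1 (1 / 2) k
    have hsign := congrArg (Int.cast : ℤ → ℝ) (sign_add_one_sub_sign_sub_one k)
    push_cast at hsign
    simp only [mul_one_div_cancel (two_ne_zero (α := ℝ)), one_mul, mul_one, cosCoeff_one]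
      at hkernel
    simp only [signAverage_zero_zero, pow_zero, one_mul, hkernel]
    rw [hsign]
    split_ifs <;> field_simp <;> ring
  | succ n ih =>
    have hkernel := cosCoeff_add_cos_mul
      (g := fun θ => (1 - 2 * (κ * (1 - κ)) * (1 - cos θ)) ^ n * (1 + cos θ)) (by fun_prop)
      (1 - 2 * (κ * (1 - κ))) (κ * (1 - κ)) k
    have hpow (θ : ℝ) : (1 - 2 * (κ * (1 - κ)) * (1 - cos θ)) ^ (n + 1) * (1 + cos θ) =
        (1 - 2 * (κ * (1 - κ)) + 2 * (κ * (1 - κ)) * cos θ) *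
          ((1 - 2 * (κ * (1 - κ)) * (1 - cos θ)) ^ n * (1 + cos θ)) := by
      ring
    have hsucc := ih (k + 1)
    have hpred := ih (k - 1)
    rw [add_sub_cancel_right] at hsucc
    rw [sub_add_cancel] at hpred
    simp only [hpow, hkernel, signAverage_succ_succ, add_sub_cancel_right, sub_add_cancel]
    linear_combination (1 - 2 * (κ * (1 - κ))) * ih k + κ * (1 - κ) * (hsucc + hpred)

theorem signAverage_self_one (κ : ℝ) (n : ℕ) :
    signAverage κ n n 1 =
      (∫ θ in (-π)..π, (1 - 2 * (κ * (1 - κ)) * (1 - cos θ)) ^ n * (1 + cos θ)) / (2 * π) := by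
  have h := signAverage_self_add_one_sub κ n 0
  simp only [zero_add, zero_sub, signAverage_self_neg, cosCoeff, Int.cast_zero, zero_mul, cos_zero,
    mul_one] at h
  rw [mul_comm 2 π, ← div_div, ← h]
  ring

end FourierRepresentation

section GaussianBound

theorem integral_exp_neg_mul_sq_le {c : ℝ} (hc : 0 < c) {a b : ℝ} (hab : a ≤ b) :
    ∫ s in a..b, exp (-c * s ^ 2) ≤ √(π / c) := by
  rw [← integral_gaussian, intervalIntegral.integral_of_le hab]
  exact MeasureTheory.setIntegral_le_integral (integrable_exp_neg_mul_sq hc)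
    (Filter.Eventually.of_forall fun _ => (exp_pos _).le)

theorem integral_comp_sin_half_mul_cos_half {f : ℝ → ℝ} (hf : Continuous f) :
    ∫ θ in (-π)..π, f (sin (θ / 2)) * cos (θ / 2) = 2 * ∫ s in (-1 : ℝ)..1, f s := by
  have hsubst := intervalIntegral.integral_comp_mul_deriv (a := -π) (b := π)
    (f := fun θ => sin (θ / 2)) (f' := fun θ => cos (θ / 2) * (1 / 2)) (g := f)
    (fun θ _ => ((hasDerivAt_id θ).div_const 2).sin) (by fun_prop) hf
  simp only [Function.comp_apply, ← mul_assoc, neg_div, sin_neg, sin_pi_div_two] at hsubst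
  rw [intervalIntegral.integral_mul_const] at hsubst
  linarith

theorem one_sub_cos_pow_mul_one_add_cos_le {p : ℝ} (hp : 4 * p ≤ 1) (n : ℕ) {θ : ℝ}
    (hθ : θ ∈ Icc (-π) π) :
    (1 - 2 * p * (1 - cos θ)) ^ n * (1 + cos θ) ≤
      2 * (exp (-(4 * p * n) * sin (θ / 2) ^ 2) * cos (θ / 2)) := by
  have hsin : 1 - cos θ = 2 * sin (θ / 2) ^ 2 := by
    rw [sin_sq_eq_half_sub, mul_div_cancel₀ θ two_ne_zero]
    ring
  have hcos : 1 + cos θ = 2 * cos (θ / 2) ^ 2 := by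
    rw [cos_sq, mul_div_cancel₀ θ two_ne_zero]
    ring
  have hcos_nonneg : 0 ≤ cos (θ / 2) :=
    cos_nonneg_of_mem_Icc ⟨by linarith [hθ.1], by linarith [hθ.2]⟩
  have hbase : 0 ≤ 1 - 4 * p * sin (θ / 2) ^ 2 :=
    sub_nonneg.2 (mul_le_one₀ hp (sq_nonneg _) (sin_sq_le_one _))
  calc (1 - 2 * p * (1 - cos θ)) ^ n * (1 + cos θ)
      = 2 * ((1 - 4 * p * sin (θ / 2) ^ 2) ^ n * cos (θ / 2) ^ 2) := by
        rw [hsin, hcos]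
        ring
    _ ≤ 2 * (exp (-(4 * p * sin (θ / 2) ^ 2)) ^ n * cos (θ / 2)) := by
        gcongr
        · exact one_sub_le_exp_neg _
        · exact pow_le_of_le_one hcos_nonneg (cos_le_one _) two_ne_zero
    _ = 2 * (exp (-(4 * p * n) * sin (θ / 2) ^ 2) * cos (θ / 2)) := by
        rw [← exp_nat_mul]
        ring_nf

theorem integral_one_sub_cos_pow_mul_one_add_cos_le {p : ℝ} (hp₀ : 0 < p) (hp : 4 * p ≤ 1) {n : ℕ}
    (hn : 0 < n) :
    ∫ θ in (-π)..π, (1 - 2 * p * (1 - cos θ)) ^ n * (1 + cos θ) ≤ 2 * √(π / (p * n)) := by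
  calc ∫ θ in (-π)..π, (1 - 2 * p * (1 - cos θ)) ^ n * (1 + cos θ)
      ≤ ∫ θ in (-π)..π, 2 * (exp (-(4 * p * n) * sin (θ / 2) ^ 2) * cos (θ / 2)) :=
        intervalIntegral.integral_mono_on (by linarith [pi_pos])
          (Continuous.intervalIntegrable (by fun_prop) _ _)
          (Continuous.intervalIntegrable (by fun_prop) _ _)
          fun _ hθ => one_sub_cos_pow_mul_one_add_cos_le hp n hθ
    _ = 2 * (2 * ∫ s in (-1 : ℝ)..1, exp (-(4 * p * n) * s ^ 2)) := by
        rw [intervalIntegral.integral_const_mul, integral_comp_sin_half_mul_cos_half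
          (f := fun s => exp (-(4 * p * n) * s ^ 2)) (by fun_prop)]
    _ ≤ 2 * (2 * √(π / (4 * p * n))) := by
        gcongr
        exact integral_exp_neg_mul_sq_le (by positivity) (by norm_num)
    _ = 2 * √(π / (p * n)) := by
        have hscale : π / (p * n) = 2 ^ 2 * (π / (4 * p * n)) := by
          field_simp
          norm_num
        rw [hscale, sqrt_mul (by positivity), sqrt_sq two_pos.le]

theorem signAverage_self_one_le {κ : ℝ} (hκ : κ ∈ Ioo (0 : ℝ) 1) {n : ℕ} (hn : 0 < n) :
    signAverage κ n n 1 ≤ 1 / √(π * κ * (1 - κ) * n) := by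
  have hp₀ : 0 < κ * (1 - κ) := mul_pos hκ.1 (sub_pos.2 hκ.2)
  have hp : 4 * (κ * (1 - κ)) ≤ 1 := by linarith [sq_nonneg (1 - 2 * κ)]
  calc signAverage κ n n 1
      ≤ 2 * √(π / (κ * (1 - κ) * n)) / (2 * π) := by
        rw [signAverage_self_one]
        gcongr
        exact integral_one_sub_cos_pow_mul_one_add_cos_le hp₀ hp hn
    _ = 1 / √(π * κ * (1 - κ) * n) := by
        have hscale : π / (κ * (1 - κ) * n) = π ^ 2 / (π * κ * (1 - κ) * n) := by
          rw [mul_assoc π, mul_assoc π]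
          field_simp
        rw [hscale, sqrt_div (by positivity), sqrt_sq pi_pos.le]
        field_simp

end GaussianBound

section AveragedIteration

variable {E : Type*} [SeminormedAddCommGroup E] [NormedSpace ℝ E] {T : E → E} {κ M : ℝ}
  {x : ℕ → E}

theorem norm_one_sub_smul_add_smul_le (hκ : κ ∈ Icc (0 : ℝ) 1) (u v : E) :
    ‖(1 - κ) • u + κ • v‖ ≤ (1 - κ) * ‖u‖ + κ * ‖v‖ :=
  convexOn_univ_norm.2 (mem_univ u) (mem_univ v) (sub_nonneg.2 hκ.2) hκ.1 (sub_add_cancel 1 κ)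

theorem norm_sub_map_le_signAverage_of_norm_sub_le (hT : LipschitzWith 1 T)
    (hκ : κ ∈ Icc (0 : ℝ) 1) (hx : ∀ n, x (n + 1) = (1 - κ) • x n + κ • T (x n)) {n : ℕ}
    (h₀ : ‖x 0 - T (x n)‖ ≤ M) (hn : ∀ m < n, ‖x m - x n‖ ≤ M * signAverage κ m n 0) {m : ℕ}
    (hmn : m ≤ n) : ‖x m - T (x n)‖ ≤ M * signAverage κ m n 1 := by
  have hκ₀ := hκ.1
  have hκ₁ := sub_nonneg.2 hκ.2
  induction m with
  | zero => rwa [signAverage_zero_left_of_pos κ n one_pos, mul_one]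
  | succ m ih =>
    have hmap : ‖T (x m) - T (x n)‖ ≤ ‖x m - x n‖ := by
      simpa only [NNReal.coe_one, one_mul] using hT.norm_sub_le (x m) (x n)
    calc ‖x (m + 1) - T (x n)‖
        = ‖(1 - κ) • (x m - T (x n)) + κ • (T (x m) - T (x n))‖ := by
          rw [hx]
          congr 1
          module
      _ ≤ (1 - κ) * ‖x m - T (x n)‖ + κ * ‖T (x m) - T (x n)‖ :=
          norm_one_sub_smul_add_smul_le hκ _ _
      _ ≤ (1 - κ) * (M * signAverage κ m n 1) + κ * (M * signAverage κ m n 0) := by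
          gcongr
          · exact ih (Nat.le_of_succ_le hmn)
          · exact hmap.trans (hn m hmn)
      _ = M * signAverage κ (m + 1) n 1 := by
          rw [signAverage_succ_left, sub_self]
          ring

theorem norm_sub_le_signAverage (hT : LipschitzWith 1 T) (hκ : κ ∈ Icc (0 : ℝ) 1)
    (hx : ∀ n, x (n + 1) = (1 - κ) • x n + κ • T (x n)) (h₀ : ∀ n, ‖x 0 - T (x n)‖ ≤ M) {m n : ℕ}
    (hmn : m ≤ n) : ‖x m - x n‖ ≤ M * signAverage κ m n 0 := by
  have hκ₀ := hκ.1
  have hκ₁ := sub_nonneg.2 hκ.2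
  induction n generalizing m with
  | zero => rw [Nat.le_zero.1 hmn, sub_self, norm_zero, signAverage_self_zero, mul_zero]
  | succ n ih =>
    rcases hmn.eq_or_lt with rfl | hlt
    · rw [sub_self, norm_zero, signAverage_self_zero, mul_zero]
    have hmn' : m ≤ n := Nat.lt_succ_iff.1 hlt
    calc ‖x m - x (n + 1)‖
        = ‖(1 - κ) • (x m - x n) + κ • (x m - T (x n))‖ := by
          rw [hx]
          congr 1
          module
      _ ≤ (1 - κ) * ‖x m - x n‖ + κ * ‖x m - T (x n)‖ := norm_one_sub_smul_add_smul_le hκ _ _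
      _ ≤ (1 - κ) * (M * signAverage κ m n 0) + κ * (M * signAverage κ m n 1) := by
          gcongr
          · exact ih hmn'
          · exact norm_sub_map_le_signAverage_of_norm_sub_le hT hκ hx (h₀ n)
              (fun _ hl => ih hl.le) hmn'
      _ = M * signAverage κ m (n + 1) 0 := by
          rw [signAverage_succ_right, zero_add]
          ring

theorem norm_sub_map_le_div_sqrt (hT : LipschitzWith 1 T) (hκ : κ ∈ Ioo (0 : ℝ) 1)
    (hx : ∀ n, x (n + 1) = (1 - κ) • x n + κ • T (x n)) (h₀ : ∀ n, ‖x 0 - T (x n)‖ ≤ M) {n : ℕ}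
    (hn : 0 < n) : ‖x n - T (x n)‖ ≤ M / √(π * κ * (1 - κ) * n) := by
  have hκ' := Ioo_subset_Icc_self hκ
  have hM : 0 ≤ M := (norm_nonneg _).trans (h₀ 0)
  calc ‖x n - T (x n)‖ ≤ M * signAverage κ n n 1 :=
        norm_sub_map_le_signAverage_of_norm_sub_le hT hκ' hx (h₀ n)
          (fun _ hm => norm_sub_le_signAverage hT hκ' hx h₀ hm.le) le_rfl
    _ ≤ M * (1 / √(π * κ * (1 - κ) * n)) := by
        gcongr
        exact signAverage_self_one_le hκ hn
    _ = M / √(π * κ * (1 - κ) * n) := mul_one_div _ _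

end AveragedIteration

end Bargaining

theorem mainTheorem11_general {V : Type*} [Fintype V] [DecidableEq V]
    (G : SimpleGraph V) [DecidableRel G.Adj] {M : ℝ} (hM : 0 < M)
    (w : Sym2 V → ℝ) (hw : ∀ e ∈ G.edgeSet, w e ≤ M)
    (b : V → ℕ) (hb : ∀ i, 1 ≤ b i)
    (κ : ℝ) (hκ : κ ∈ Ioo (0 : ℝ) 1)
    (α₀ : Bargaining.Messages G) (hα₀ : ∀ d, α₀ d ∈ Icc 0 M)
    (ε : ℝ) (hε : 0 < ε)
    (t : ℕ) (ht : M ^ 2 / (π * κ * (1 - κ) * ε ^ 2) ≤ t) :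
    Bargaining.IsApproxFixedPoint G w b ε (Bargaining.naturalDynamics G w b κ α₀ t) := by
  have hc : 0 < π * κ * (1 - κ) := mul_pos (mul_pos pi_pos hκ.1) (sub_pos.2 hκ.2)
  have ht₀ : (0 : ℝ) < t := lt_of_lt_of_le (by positivity) ht
  have hrate := Bargaining.norm_sub_map_le_div_sqrt
    (Bargaining.lipschitzWith_bestAlternative G w hb) hκ
    (x := Bargaining.naturalDynamics G w b κ α₀) (fun _ => rfl)
    (Bargaining.norm_sub_bestAlternative_naturalDynamics_le G hM.le hw b
      (Ioo_subset_Icc_self hκ) hα₀) (Nat.cast_pos.1 ht₀)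
  have hε_le : M / √(π * κ * (1 - κ) * t) ≤ ε := by
    rw [div_le_comm₀ (by positivity) hε]
    refine le_sqrt_of_sq_le ?_
    rw [div_le_iff₀ (by positivity)] at ht
    rw [div_pow, div_le_iff₀ (by positivity)]
    linarith
  exact fun d => (norm_le_pi_norm _ d).trans (hrate.trans hε_le)

theorem mainTheorem11 {V : Type*} [Fintype V] [DecidableEq V]
    (G : SimpleGraph V) [DecidableRel G.Adj]
    (w : Sym2 V → ℝ) (hw : ∀ e ∈ G.edgeSet, w e ∈ Set.Icc (0 : ℝ) 1)
    (b : V → ℕ) (hb : ∀ i, 1 ≤ b i)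
    (κ : ℝ) (hκ : κ ∈ Set.Ioo (0 : ℝ) 1)
    (α₀ : Bargaining.Messages G) (hα₀ : ∀ d, α₀ d ∈ Set.Icc (0 : ℝ) 1)
    (ε : ℝ) (hε : 0 < ε)
    (t : ℕ) (ht : 1 / (Real.pi * κ * (1 - κ) * ε ^ 2) ≤ (t : ℝ)) :
    Bargaining.IsApproxFixedPoint G w b ε (Bargaining.naturalDynamics G w b κ α₀ t) :=
  mainTheorem11_general G one_pos w (fun e he => (hw e he).2) b hb κ hκ α₀ hα₀ ε hε t
    (by rwa [one_pow])
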